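/- **Definitions.** Let $\Sigma=\{a,b\}$. All automata below are finite, deterministic and complete. For $L\subseteq\Sigma^\omega$ let $x\sim_L y$ (for $x,y\in\Sigma^*$) mean that $xw\in L\iff yw\in L$ for all $w\in\Sigma^\omega$. The rightcon automaton of $L$ has the classes of $\sim_L$ as states, initial state $[\epsilon]$ and transitions $\delta([u],\sigma)=[u\sigma]$. Let $\mathbb{IM}$ (resp. $\mathbb{IP}$, $\mathbb{IT}$) be the class of languages $L$ accepted by a Muller (resp. parity, transition-table) automaton that is isomorphic, as an automaton without acceptance condition, to the rightcon automaton of $L$. Here a Muller automaton accepts if the set of states visited infinitely often belongs to a given family $F$ of sets of states; a transition-table automaton accepts if the set of transitions taken infinitely often belongs to a given family of sets of transitions; a parity automaton, with colors in $\{1,\dots,k\}$ for some $k$, accepts if the minimal color visited infinitely often is odd. An SCC of a Muller automaton is a nonempty set $S$ of states, reachable from the initial state and not necessarily maximal, such that any $t\in S$ can be reached from any $s\in S$ by a nonempty path inside $S$; it is accepting if $S\in F$ and rejecting otherwise. A chain with $k$ alternations is a strictly increasing sequence $S_0\subset S_1\subset\dots\subset S_k$ of SCCs that are alternately accepting and rejecting;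 it has polarity $+$ if $S_0$ is accepting and $-$ if $S_0$ is rejecting. For integers $n,m$ and $p\in\{+,-,\pm\}$, the Wagner class $\mathbb{DM}^p_{n,m}$ consists of the languages accepted by some Muller automaton in which - every chain has at most $n$ alternations; - every sequence of chains with exactly $n$ alternations each, of alternating polarity, and each accessible from the preceding one, consists of at most $m$ chains; - if $p\in\{+,-\}$, every nonempty such sequence of exactly $m$ chains starts with a chain of polarity $p$ (for $p=\pm$ there is no such condition). In particular $\mathbb{DM}^p_{n,m}=\emptyset$ if $n<0$ or $m<0$. **Proposition.** Let $n,m\ge 0$ be integers, not both $0$, and let $p\in\{+,-,\pm\}$. Then there is a language $L\subseteq\{a,b\}^\omega$ such that $$L\in\mathbb{IT}\cap\mathbb{IM}\cap\mathbb{IP}\cap\mathbb{DM}^p_{n,m},\qquad L\notin\mathbb{DM}^p_{n-1,m}\qquad\text{and}\qquad L\notin\mathbb{DM}^p_{n,m-1}.$$ -/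

import Mathlib

namespace Rightcon

open Filter

/-- The two-letter alphabet `{a, b}`. -/
inductive Letter where
  | a : Letter
  | b : Letter
  deriving DecidableEq

/-- A complete deterministic automaton over the alphabet `A` with states `Q`, without acceptance
condition. Infinite words are `Stream' A`, finite words are `List A`. -/
structure Automaton (A Q : Type) where
  /-- The initial state. -/
  init : Q
  /-- The transition function. -/
  step : Q → A → Q

namespace Automaton

variable {A Q Q' : Type}

/-- The state reached from `s` after reading the finite word `x`. -/
def evalFrom (M : Automaton A Q) (s : Q) (x : List A) : Q :=
  x.foldl M.step s

/-- The run on an infinite word: `M.run w i` is the state after the first `i` letters of `w`. -/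
def run (M : Automaton A Q) (w : Stream' A) : ℕ → Q
  | 0 => M.init
  | i + 1 => M.step (M.run w i) (w.get i)

/-- The set of states visited infinitely often in the run on `w`. -/
def infStates (M : Automaton A Q) (w : Stream' A) : Set Q :=
  {q | ∃ᶠ i in atTop, M.run w i = q}

/-- The set of transitions taken infinitely often in the run on `w`. -/
def infTransitions (M : Automaton A Q) (w : Stream' A) : Set (Q × A × Q) :=
  {t | ∃ᶠ i in atTop, (M.run w i, w.get i, M.run w (i + 1)) = t}

/-- The language accepted with the Muller condition `F`. -/
def mullerLanguage (M : Automaton A Q) (F : Set (Set Q)) : Set (Stream' A) :=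
  {w | M.infStates w ∈ F}

/-- The language accepted with the transition-table condition `T`. -/
def tableLanguage (M : Automaton A Q) (T : Set (Set (Q × A × Q))) : Set (Stream' A) :=
  {w | M.infTransitions w ∈ T}

/-- The language accepted with the parity condition `κ`: the minimal color that occurs infinitely
often in the run is odd. -/
def parityLanguage (M : Automaton A Q) (κ : Q → ℕ) : Set (Stream' A) :=
  {w | ∃ c, IsLeast {c | ∃ᶠ i in atTop, κ (M.run w i) = c} c ∧ Odd c}

/-- Isomorphism of automata: a bijection of the states that respects the initial states and the
transitions. -/
def IsIsomorphic (M : Automaton A Q) (N : Automaton A Q') : Prop :=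
  ∃ e : Q ≃ Q', e M.init = N.init ∧ ∀ q c, e (M.step q c) = N.step (e q) c

/-- `S` is a strongly connected set of states of `M`, not necessarily maximal, that is reachable
from the initial state: any state of `S` can be reached from any state of `S` by a nonempty path
that stays in `S`. -/
structure IsSCC (M : Automaton A Q) (S : Set Q) : Prop where
  nonempty : S.Nonempty
  connected : ∀ s ∈ S, ∀ t ∈ S, ∃ x : List A, x ≠ [] ∧ M.evalFrom s x = t ∧
    ∀ y, y <+: x → M.evalFrom s y ∈ S
  reachable : ∀ s ∈ S, ∃ x : List A, M.evalFrom M.init x = s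

/-- `S 0 ⊂ S 1 ⊂ ⋯ ⊂ S k` is an inclusion chain of SCCs that are alternately accepting and
rejecting for the Muller condition `F`. It has `k` alternations; it is positive if
`S 0` is accepting and negative if `S 0` is rejecting. -/
structure IsChain (M : Automaton A Q) (F : Set (Set Q)) (k : ℕ) (S : Fin (k + 1) → Set Q) :
    Prop where
  scc : ∀ i, M.IsSCC (S i)
  strictMono : StrictMono S
  alternates : ∀ i : Fin k, S i.castSucc ∈ F ↔ S i.succ ∉ F

/-- `C 0, …, C (r - 1)` is a sequence of `r` chains with `k` alternations each, of alternating
polarity, in which each chain is accessible from the preceding one. -/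
structure IsSuperchain (M : Automaton A Q) (F : Set (Set Q)) (k r : ℕ)
    (C : Fin r → Fin (k + 1) → Set Q) : Prop where
  chain : ∀ i, M.IsChain F k (C i)
  accessible : ∀ i j : Fin r, (j : ℕ) = i + 1 →
    ∃ s ∈ C i 0, ∃ t ∈ C j 0, ∃ x : List A, M.evalFrom s x = t
  alternates : ∀ i j : Fin r, (j : ℕ) = i + 1 → (C i 0 ∈ F ↔ C j 0 ∉ F)

end Automaton

section Classes

variable {A : Type}

/-- The canonical right congruence of an `ω`-language. -/
def rightCongruence (L : Set (Stream' A)) : Setoid (List A) where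
  r x y := ∀ w : Stream' A, x ++ₛ w ∈ L ↔ y ++ₛ w ∈ L
  iseqv :=
    { refl := fun _ _ => Iff.rfl
      symm := fun h w => (h w).symm
      trans := fun h h' w => (h w).trans (h' w) }

theorem rightCongruence_append (L : Set (Stream' A)) {x y : List A}
    (h : (rightCongruence L).r x y) (c : A) :
    (rightCongruence L).r (x ++ [c]) (y ++ [c]) := by
  intro w
  rw [Stream'.append_append_stream, Stream'.append_append_stream]
  exact h _

/-- The rightcon automaton of `L`: its states are the classes of the right congruence of `L`, the
initial state is `[ε]`, and reading `c` leads from `[x]` to `[xc]`. -/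
def rightcon (L : Set (Stream' A)) : Automaton A (Quotient (rightCongruence L)) where
  init := Quotient.mk _ []
  step q c := Quotient.map (fun x => x ++ [c]) (fun _ _ h => rightCongruence_append L h c) q

variable (A)

/-- Languages accepted by a deterministic Muller automaton isomorphic to the rightcon automaton. -/
def IM : Set (Set (Stream' A)) :=
  {L | ∃ (Q : Type) (_ : Finite Q) (M : Automaton A Q) (F : Set (Set Q)),
    M.IsIsomorphic (rightcon L) ∧ M.mullerLanguage F = L}

/-- Languages accepted by a deterministic transition-table automaton isomorphic to the rightcon
automaton. -/
def IT : Set (Set (Stream' A)) :=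
  {L | ∃ (Q : Type) (_ : Finite Q) (M : Automaton A Q) (T : Set (Set (Q × A × Q))),
    M.IsIsomorphic (rightcon L) ∧ M.tableLanguage T = L}

/-- Languages accepted by a deterministic parity automaton isomorphic to the rightcon automaton. -/
def IP : Set (Set (Stream' A)) :=
  {L | ∃ (Q : Type) (_ : Finite Q) (M : Automaton A Q) (k : ℕ) (κ : Q → ℕ),
    (∀ q, κ q ∈ Set.Icc 1 k) ∧ M.IsIsomorphic (rightcon L) ∧ M.parityLanguage κ = L}

end Classes

/-- The polarities `+`, `-` and `±`. -/
inductive Polarity where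
  | pos : Polarity
  | neg : Polarity
  | both : Polarity

/-- Whether a sequence of chains may start with a chain whose smallest SCC is accepting
(`accepting` holds) or rejecting (`accepting` fails). -/
def Polarity.Admits (p : Polarity) (accepting : Prop) : Prop :=
  match p with
  | .pos => accepting
  | .neg => ¬ accepting
  | .both => True

/-- The Wagner class `DM_{n,m}^p`: the languages accepted by a deterministic Muller automaton in
which every chain has at most `n` alternations, every sequence of chains with `n` alternations each
(of alternating polarity, each chain accessible from the preceding one) consists of at most `m`
chains, and every such sequence that consists of exactly `m` chains starts with polarity `p`.
The indices are integers, and the class is empty if one of them is negative. -/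
def DM (A : Type) (p : Polarity) (n m : ℤ) : Set (Set (Stream' A)) :=
  {L | ∃ (Q : Type) (_ : Finite Q) (M : Automaton A Q) (F : Set (Set Q)),
    M.mullerLanguage F = L ∧
    (∀ (k : ℕ) (S : Fin (k + 1) → Set Q), M.IsChain F k S → (k : ℤ) ≤ n) ∧
    (∀ (k r : ℕ) (C : Fin r → Fin (k + 1) → Set Q), (k : ℤ) = n → M.IsSuperchain F k r C →
      (r : ℤ) ≤ m ∧
      ((r : ℤ) = m → ∀ i : Fin r, (i : ℕ) = 0 → p.Admits (C i 0 ∈ F)))}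

end Rightcon

/-!
The witnesses are the languages of parity automata that look like ladders. A ladder has `B` blocks
of `n + 1` states and a final sink. The letter `a` moves one state forward, from the last state of
a block into the next block, and `b` moves back to the start of the current block. In block `i` the
colors decrease from `d + i + n` to `d + i`. The SCCs of a block are thus its initial segments; they
form a single inclusion chain with `n` alternations, and the polarity of this chain alternates with
the number of the block.

*Rightcon.* All states are reachable. Two states are distinguished by a word `a ⋯ a b b b ⋯` that
takes the later state to the sink and the earlier one only to the last block
(`ladder_distinguishable`). Hence the ladder is the rightcon automaton of its language
(`isIsomorphic_rightcon`), and its parity condition is also a Muller condition and a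
transition-table condition.

*Membership in the Wagner class.* Along a chain of SCCs the minimal colors strictly decrease inside
one block, which bounds the number of alternations (`ladder_chain`). Along a superchain the blocks
strictly increase, which bounds its length, and a superchain of maximal length starts in the
first block, whose parity fixes the polarity (`ladder_superchain`).

*Non-membership.* Every Muller automaton `M` for the language has a superchain as long as that of
the ladder (`exists_superchain`). Its SCCs in `M` are orbits of the loop words `y₀ = b` and
`y_{j+1} = y_j ^ K a ^ (j+1) b`, where `K` is the number of states of `M`. In the ladder the word
`y_j` loops through the first `j + 1` states of a block, and this determines the acceptance of the
orbit in `M`. By the pigeonhole principle the orbit of `y_j` is already visited while reading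
`y_j ^ K`, so the orbits from a common state are nested (`orbit_subset_of_rep_prefix`).

For `n = 0` the sink itself serves as the last block. For `m = 0` the class `DM_{n,0}` only
forbids chains with `n` alternations, and the ladder for `n - 1` with one chain is a witness.
-/

namespace Rightcon

open Filter

/-! ### Finite and infinite runs -/

/-- The finite word `y ⋯ y` with `k` factors. -/
def rep {A : Type} (k : ℕ) (y : List A) : List A :=
  (List.replicate k y).flatten

theorem rep_succ {A : Type} (k : ℕ) (y : List A) : rep (k + 1) y = y ++ rep k y := by
  simp [rep, List.replicate_succ]

theorem length_rep {A : Type} (k : ℕ) (y : List A) : (rep k y).length = k * y.length := by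
  simp [rep]

theorem rep_append_cycle {A : Type} (k : ℕ) {y : List A} (hy : y ≠ []) :
    rep k y ++ₛ Stream'.cycle y hy = Stream'.cycle y hy := by
  induction k with
  | zero => simp [rep]
  | succ k ih =>
    rw [rep_succ, Stream'.append_append_stream, ih]
    exact (Stream'.cycle_eq y hy).symm

namespace Automaton

variable {A Q Q' : Type}

/-- The automaton `M` with initial state `p`. -/
def startAt (M : Automaton A Q) (p : Q) : Automaton A Q where
  init := p
  step := M.step

theorem evalFrom_append (M : Automaton A Q) (p : Q) (x y : List A) :
    M.evalFrom p (x ++ y) = M.evalFrom (M.evalFrom p x) y :=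
  List.foldl_append

theorem evalFrom_rep (M : Automaton A Q) (p : Q) (k : ℕ) (y : List A) :
    M.evalFrom p (rep k y) = (fun q => M.evalFrom q y)^[k] p := by
  induction k generalizing p with
  | zero => rfl
  | succ k ih => rw [rep_succ, evalFrom_append, ih, Function.iterate_succ_apply]

theorem run_eq_evalFrom_take (M : Automaton A Q) (w : Stream' A) (i : ℕ) :
    M.run w i = M.evalFrom M.init (w.take i) := by
  induction i with
  | zero => rfl
  | succ i ih =>
    rw [Stream'.take_succ', evalFrom_append, ← ih]
    rfl

theorem run_append_length_add (M : Automaton A Q) (x : List A) (w : Stream' A) (i : ℕ) :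
    M.run (x ++ₛ w) (x.length + i) = (M.startAt (M.evalFrom M.init x)).run w i := by
  induction x generalizing M with
  | nil => simp [startAt, evalFrom]
  | cons c x ih =>
    have h : ∀ (v : Stream' A) (j : ℕ), M.run (Stream'.cons c v) (j + 1) =
        (M.startAt (M.step M.init c)).run v j := by
      intro v j
      induction j with
      | zero => rfl
      | succ j ihj =>
        change M.step (M.run (Stream'.cons c v) (j + 1)) _ = M.step _ _
        rw [ihj]
        rfl
    rw [Stream'.cons_append_stream, List.length_cons, Nat.add_right_comm, h, ih]
    rfl

theorem run_append_of_le (M : Automaton A Q) (x : List A) (w : Stream' A) {i : ℕ}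
    (hi : i ≤ x.length) : M.run (x ++ₛ w) i = M.evalFrom M.init (x.take i) := by
  rw [run_eq_evalFrom_take, Stream'.take_append_of_le_length _ _ _ hi]

theorem infStates_append (M : Automaton A Q) (x : List A) (w : Stream' A) :
    M.infStates (x ++ₛ w) = (M.startAt (M.evalFrom M.init x)).infStates w := by
  ext q
  simp only [infStates, Set.mem_ofPred_eq, ← run_append_length_add,
    Nat.add_comm x.length]
  conv_lhs => rw [← Filter.map_add_atTop_eq_nat x.length, Filter.frequently_map]

theorem infStates_nonempty [Finite Q] (M : Automaton A Q) (w : Stream' A) :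
    (M.infStates w).Nonempty := by
  have h : ∃ᶠ i in atTop, ∃ q, M.run w i = q :=
    Filter.Frequently.of_forall fun i => ⟨_, rfl⟩
  obtain ⟨q, hq⟩ := Filter.frequently_exists.1 h
  exact ⟨q, hq⟩

/-- The states visited infinitely often form an SCC: after some time only these states are visited,
and each of them is followed by each other one. -/
theorem isSCC_infStates [Finite Q] (M : Automaton A Q) (w : Stream' A) :
    M.IsSCC (M.infStates w) := by
  refine ⟨M.infStates_nonempty w, ?_, ?_⟩
  · have hev : ∀ᶠ i in atTop, M.run w i ∈ M.infStates w := by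
      have : ∀ q : Q, ∀ᶠ i in atTop, q ∉ M.infStates w → M.run w i ≠ q := by
        intro q
        by_cases hq : q ∈ M.infStates w
        · exact Filter.Eventually.of_forall fun i h => absurd hq h
        · filter_upwards [Filter.not_frequently.1 hq] with i hi _ using hi
      filter_upwards [Filter.eventually_all.2 this] with i hi
      by_contra h
      exact hi _ h rfl
    obtain ⟨N, hN⟩ := Filter.eventually_atTop.1 hev
    intro s hs t ht
    obtain ⟨i, hi, his⟩ := Filter.frequently_atTop.1 hs N
    obtain ⟨j, hj, hjt⟩ := Filter.frequently_atTop.1 ht (i + 1)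
    have key : ∀ l, M.evalFrom s ((w.drop i).take l) = M.run w (i + l) := by
      intro l
      conv_rhs => rw [← Stream'.append_take_drop i w]
      have := M.run_append_length_add (w.take i) (w.drop i) l
      rw [Stream'.length_take] at this
      rw [this, ← run_eq_evalFrom_take, his, run_eq_evalFrom_take]
      rfl
    refine ⟨(w.drop i).take (j - i), ?_, ?_, ?_⟩
    · intro h
      have := congrArg List.length h
      rw [Stream'.length_take, List.length_nil] at this
      omega
    · rw [key, Nat.add_sub_cancel' (by omega), hjt]
    · intro y hy
      rw [List.prefix_iff_eq_take.1 hy, Stream'.take_take, key]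
      exact hN _ (by omega)
  · intro s hs
    obtain ⟨i, hi⟩ := hs.exists
    exact ⟨w.take i, by rw [← run_eq_evalFrom_take, hi]⟩

/-! ### Periodic words -/

/-- The set of states visited from `p` when reading `y` again and again. -/
def orbit (M : Automaton A Q) (p : Q) (y : List A) (hy : y ≠ []) : Set Q :=
  Set.range ((M.startAt p).run (Stream'.cycle y hy))

theorem mem_orbit_self (M : Automaton A Q) (p : Q) {y : List A} (hy : y ≠ []) :
    p ∈ M.orbit p y hy :=
  ⟨0, rfl⟩

theorem run_cycle_add (M : Automaton A Q) (p : Q) {y : List A} (hy : y ≠ []) (d i : ℕ) :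
    (M.startAt p).run (Stream'.cycle y hy) (d * y.length + i) =
      (M.startAt (M.evalFrom p (rep d y))).run (Stream'.cycle y hy) i := by
  conv_lhs => rw [← rep_append_cycle d hy, ← length_rep, run_append_length_add]
  rfl

theorem orbit_evalFrom_rep_subset (M : Automaton A Q) (p : Q) {y : List A} (hy : y ≠ []) (k : ℕ) :
    M.orbit (M.evalFrom p (rep k y)) y hy ⊆ M.orbit p y hy := by
  rintro _ ⟨i, rfl⟩
  exact ⟨k * y.length + i, M.run_cycle_add p hy k i⟩

/-- From a state to which some power of `y` returns, every state visited while reading `y`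
repeatedly is visited infinitely often. -/
theorem infStates_append_cycle (M : Automaton A Q) (u : List A) {y : List A} (hy : y ≠ []) {d : ℕ}
    (hd : 0 < d)
    (h : M.evalFrom (M.evalFrom M.init u) (rep d y) = M.evalFrom M.init u) :
    M.infStates (u ++ₛ Stream'.cycle y hy) = M.orbit (M.evalFrom M.init u) y hy := by
  rw [infStates_append]
  set p := M.evalFrom M.init u
  have hper : ∀ k i, (M.startAt p).run (Stream'.cycle y hy) (k * (d * y.length) + i) =
      (M.startAt p).run (Stream'.cycle y hy) i := by
    intro k i
    induction k with
    | zero => simp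
    | succ k ih => rw [Nat.succ_mul, Nat.add_comm (k * _), Nat.add_assoc, run_cycle_add, h, ih]
  ext q
  constructor
  · intro hq
    obtain ⟨i, hi⟩ := hq.exists
    exact ⟨i, hi⟩
  · rintro ⟨i, rfl⟩
    refine Filter.frequently_atTop.2 fun k => ⟨k * (d * y.length) + i, ?_, hper k i⟩
    have : 0 < d * y.length := Nat.mul_pos hd (List.length_pos_iff.2 hy)
    nlinarith

theorem exists_evalFrom_rep_eq [Finite Q] (M : Automaton A Q) (p : Q) (y : List A) :
    ∃ i j, i < j ∧ j ≤ Nat.card Q ∧ M.evalFrom p (rep i y) = M.evalFrom p (rep j y) := by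
  have := Fintype.ofFinite Q
  obtain ⟨i, j, hij, h⟩ := Fintype.exists_ne_map_eq_of_card_lt
    (fun i : Fin (Nat.card Q + 1) => M.evalFrom p (rep i y))
    (by rw [Fintype.card_fin, Nat.card_eq_fintype_card]; exact Nat.lt_succ_self _)
  rcases lt_or_gt_of_ne hij with h' | h'
  · exact ⟨i, j, h', Nat.lt_succ_iff.1 j.2, h⟩
  · exact ⟨j, i, h', Nat.lt_succ_iff.1 i.2, h.symm⟩

/-- After `Nat.card Q` repetitions of `y` the run has entered its cycle. -/
theorem exists_evalFrom_rep_card [Finite Q] (M : Automaton A Q) (p : Q) (y : List A) :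
    ∃ d, 0 < d ∧ M.evalFrom (M.evalFrom p (rep (Nat.card Q) y)) (rep d y) =
      M.evalFrom p (rep (Nat.card Q) y) := by
  obtain ⟨i, j, hij, hj, h⟩ := M.exists_evalFrom_rep_eq p y
  refine ⟨j - i, by omega, ?_⟩
  simp only [evalFrom_rep] at h ⊢
  obtain ⟨c, hc⟩ := Nat.exists_eq_add_of_le (hij.le.trans hj)
  rw [hc, ← Function.iterate_add_apply, show j - i + (i + c) = c + j by omega,
    Nat.add_comm i c, Function.iterate_add_apply, Function.iterate_add_apply _ c i, h]

/-- By the pigeonhole principle every state that is ever visited while reading `y` repeatedly is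
visited during the first `Nat.card Q` repetitions. -/
theorem orbit_subset_of_rep_prefix [Finite Q] (M : Automaton A Q) (p : Q) {y z : List A}
    (hy : y ≠ []) (hz : rep (Nat.card Q) y ++ z ≠ []) :
    M.orbit p y hy ⊆ M.orbit p (rep (Nat.card Q) y ++ z) hz := by
  rintro _ ⟨t, rfl⟩
  obtain ⟨i, j, hij, hj, h⟩ := M.exists_evalFrom_rep_eq p y
  have hpos : 0 < y.length := List.length_pos_iff.2 hy
  induction t using Nat.strong_induction_on with
  | _ t ih =>
    by_cases ht : t ≤ (rep (Nat.card Q) y).length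
    · refine ⟨t, ?_⟩
      conv_rhs => rw [← rep_append_cycle (Nat.card Q) hy]
      rw [Stream'.cycle_eq, Stream'.append_append_stream, run_append_of_le _ _ _ ht,
        run_append_of_le _ _ _ ht]
    · rw [length_rep] at ht
      have h1 : j * y.length ≤ t :=
        (Nat.mul_le_mul_right _ hj).trans (not_le.1 ht).le
      have h2 : i * y.length < j * y.length := Nat.mul_lt_mul_of_pos_right hij hpos
      obtain ⟨c, rfl⟩ := Nat.exists_eq_add_of_le h1
      rw [run_cycle_add, ← h, ← run_cycle_add]
      exact ih _ (by omega)

theorem isSCC_orbit [Finite Q] (M : Automaton A Q) (u : List A) {y : List A} (hy : y ≠ []) {d : ℕ}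
    (hd : 0 < d)
    (h : M.evalFrom (M.evalFrom M.init u) (rep d y) = M.evalFrom M.init u) :
    M.IsSCC (M.orbit (M.evalFrom M.init u) y hy) := by
  rw [← M.infStates_append_cycle u hy hd h]
  exact M.isSCC_infStates _

/-! ### Runs confined to a set of states -/

/-- The run on the finite word `x` from `p` stays inside `S`. -/
def Stays (M : Automaton A Q) (S : Set Q) (p : Q) (x : List A) : Prop :=
  ∀ y, y <+: x → M.evalFrom p y ∈ S

theorem Stays.append {M : Automaton A Q} {S : Set Q} {p : Q} {x y : List A} (hx : M.Stays S p x)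
    (hy : M.Stays S (M.evalFrom p x) y) : M.Stays S p (x ++ y) := by
  intro z hz
  rcases List.prefix_or_prefix_of_prefix hz (List.prefix_append x y) with h | h
  · exact hx z h
  · obtain ⟨t, rfl⟩ := h
    rw [evalFrom_append]
    exact hy t ((List.prefix_append_right_inj x).1 hz)

theorem evalFrom_rep_of_fixed (M : Automaton A Q) {p : Q} {x : List A} (h : M.evalFrom p x = p)
    (k : ℕ) : M.evalFrom p (rep k x) = p := by
  rw [evalFrom_rep]
  exact Function.iterate_fixed h k

theorem Stays.rep {M : Automaton A Q} {S : Set Q} {p : Q} {x : List A} (hx : M.Stays S p x)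
    (h : M.evalFrom p x = p) (k : ℕ) : M.Stays S p (rep k x) := by
  induction k with
  | zero =>
    intro z hz
    rw [List.prefix_nil.1 hz]
    exact hx [] List.nil_prefix
  | succ k ih =>
    rw [rep_succ]
    exact hx.append (by rwa [h])

theorem Stays.orbit_subset {M : Automaton A Q} {S : Set Q} {p : Q} {x : List A}
    (hx : M.Stays S p x) (h : M.evalFrom p x = p) (hne : x ≠ []) : M.orbit p x hne ⊆ S := by
  rintro _ ⟨t, rfl⟩
  rw [← rep_append_cycle t hne, run_append_of_le]
  · exact hx.rep h t _ (List.take_prefix _ _)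
  · rw [length_rep]
    exact Nat.le_mul_of_pos_right t (List.length_pos_iff.2 hne)

theorem evalFrom_mem_orbit (M : Automaton A Q) (p : Q) {x z : List A} (hne : x ≠ [])
    (hz : z <+: x) : M.evalFrom p z ∈ M.orbit p x hne := by
  obtain ⟨y, rfl⟩ := hz
  refine ⟨z.length, ?_⟩
  rw [Stream'.cycle_eq, run_append_of_le _ _ _ (by simp), List.take_left]
  rfl

theorem infStates_append_cycle_of_fixed (M : Automaton A Q) (u : List A) (c : A)
    {r : Q} (hu : M.evalFrom M.init u = r) (hr : M.evalFrom r [c] = r) :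
    M.infStates (u ++ₛ Stream'.cycle [c] (List.cons_ne_nil c [])) = {r} := by
  subst hu
  rw [M.infStates_append_cycle u _ Nat.one_pos (M.evalFrom_rep_of_fixed hr 1)]
  refine Set.Subset.antisymm (Stays.orbit_subset ?_ hr _) ?_
  · intro y hy
    rcases List.prefix_cons_iff.1 hy with rfl | ⟨t, rfl, ht⟩
    · rfl
    · rw [List.prefix_nil.1 ht]
      exact hr
  · rw [Set.singleton_subset_iff]
    exact M.mem_orbit_self _ _

/-! ### Isomorphism with the rightcon automaton -/

theorem mem_mullerLanguage_append (M : Automaton A Q) (F : Set (Set Q)) (x : List A)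
    (w : Stream' A) : x ++ₛ w ∈ M.mullerLanguage F ↔
      w ∈ (M.startAt (M.evalFrom M.init x)).mullerLanguage F := by
  simp only [mullerLanguage, Set.mem_ofPred_eq, infStates_append]

/-- A Muller automaton is isomorphic to the rightcon automaton of its language if all its states
are reachable and any two of them accept different languages. -/
theorem isIsomorphic_rightcon (M : Automaton A Q) (F : Set (Set Q))
    (hreach : ∀ q, ∃ x, M.evalFrom M.init x = q)
    (hdist : ∀ p q, (M.startAt p).mullerLanguage F = (M.startAt q).mullerLanguage F → p = q) :
    M.IsIsomorphic (rightcon (M.mullerLanguage F)) := by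
  have key : ∀ x y, (rightCongruence (M.mullerLanguage F)).r x y ↔
      M.evalFrom M.init x = M.evalFrom M.init y := by
    intro x y
    constructor
    · intro h
      apply hdist
      ext w
      rw [← mem_mullerLanguage_append, ← mem_mullerLanguage_append]
      exact h w
    · intro h w
      rw [mem_mullerLanguage_append, mem_mullerLanguage_append, h]
  let g : Quotient (rightCongruence (M.mullerLanguage F)) → Q :=
    Quotient.lift (M.evalFrom M.init) fun x y h => (key x y).1 h
  have hg : Function.Bijective g := by
    constructor
    · rintro ⟨x⟩ ⟨y⟩ h
      exact Quotient.sound ((key x y).2 h)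
    · intro q
      obtain ⟨x, hx⟩ := hreach q
      exact ⟨Quotient.mk _ x, hx⟩
  refine ⟨(Equiv.ofBijective g hg).symm, ?_, ?_⟩
  · rw [Equiv.symm_apply_eq]
    rfl
  · intro q c
    rw [Equiv.symm_apply_eq]
    obtain ⟨r, rfl⟩ := hg.2 q
    rw [show (Equiv.ofBijective g hg).symm (g r) = r from
      (Equiv.ofBijective g hg).symm_apply_apply r]
    induction r using Quotient.inductionOn with
    | h x => exact (M.evalFrom_append M.init x [c]).symm

/-! ### Parity and transition-table conditions as Muller conditions -/

/-- The Muller condition that expresses the parity condition `κ`. -/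
def parityFamily (κ : Q → ℕ) : Set (Set Q) :=
  {S | ∃ c, IsLeast (κ '' S) c ∧ Odd c}

theorem mem_parityFamily_iff {κ : Q → ℕ} {S : Set Q} {c : ℕ} (h : IsLeast (κ '' S) c) :
    S ∈ parityFamily κ ↔ Odd c := by
  constructor
  · rintro ⟨c', h', ho⟩
    rwa [h.unique h']
  · exact fun ho => ⟨c, h, ho⟩

theorem parityLanguage_eq_mullerLanguage [Finite Q] (M : Automaton A Q) (κ : Q → ℕ) :
    M.parityLanguage κ = M.mullerLanguage (parityFamily κ) := by
  ext w
  have h : {c | ∃ᶠ i in atTop, κ (M.run w i) = c} = κ '' M.infStates w := by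
    ext c
    constructor
    · intro hc
      have : ∃ᶠ i in atTop, ∃ q, M.run w i = q ∧ κ q = c :=
        Filter.Frequently.mono hc fun i hi => ⟨_, rfl, hi⟩
      obtain ⟨q, hq⟩ := Filter.frequently_exists.1 this
      exact ⟨q, hq.mono fun i hi => hi.1, hq.exists.choose_spec.2⟩
    · rintro ⟨q, hq, rfl⟩
      exact Filter.Frequently.mono hq fun i hi => congrArg κ hi
  simp only [parityLanguage, mullerLanguage, parityFamily, Set.mem_ofPred_eq, h]

theorem image_fst_infTransitions [Finite A] [Finite Q] (M : Automaton A Q) (w : Stream' A) :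
    Prod.fst '' M.infTransitions w = M.infStates w := by
  ext q
  constructor
  · rintro ⟨t, ht, rfl⟩
    exact Filter.Frequently.mono ht fun i hi => congrArg Prod.fst hi
  · intro hq
    have : ∃ᶠ i in atTop, ∃ r : A × Q, (M.run w i, w.get i, M.run w (i + 1)) = (q, r) :=
      Filter.Frequently.mono hq fun i hi => ⟨_, by rw [hi]⟩
    obtain ⟨r, hr⟩ := Filter.frequently_exists.1 this
    exact ⟨(q, r), hr, rfl⟩

theorem tableLanguage_eq_mullerLanguage [Finite A] [Finite Q] (M : Automaton A Q)
    (F : Set (Set Q)) :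
    M.tableLanguage {T | Prod.fst '' T ∈ F} = M.mullerLanguage F := by
  ext w
  simp only [tableLanguage, mullerLanguage, Set.mem_ofPred_eq, image_fst_infTransitions]

end Automaton

/-! ### The ladder automaton -/

/-- The ladder with `B` blocks of `n + 1` states each, followed by a sink `(n + 1) * B`. The `j`-th
state of block `i` is `(n + 1) * i + j`. The letter `a` leads to the next state, and thus from the
last state of a block to the next block; the letter `b` leads back to the start of the block. -/
def ladder (n B : ℕ) : Automaton Letter (Fin ((n + 1) * B + 1)) where
  init := 0
  step q c :=
    match c with
    | .a => ⟨min (q + 1) ((n + 1) * B), Nat.lt_succ_of_le (min_le_right _ _)⟩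
    | .b => ⟨(n + 1) * (q / (n + 1)), (Nat.mul_div_le _ _).trans_lt q.2⟩

/-- The coloring of the ladder: inside a block the colors decrease from `d + i + n` to `d + i`,
where `i` is the number of the block. -/
def ladderColor (n d : ℕ) {N : ℕ} (q : Fin N) : ℕ :=
  d + q / (n + 1) + (n - q % (n + 1))

theorem ladderColor_of_val {n d N i j : ℕ} {q : Fin N} (hj : j ≤ n)
    (hq : (q : ℕ) = (n + 1) * i + j) : ladderColor n d q = d + i + (n - j) := by
  have h1 : (q : ℕ) / (n + 1) = i := by
    rw [hq, Nat.mul_add_div (Nat.succ_pos n), Nat.div_eq_of_lt (Nat.lt_succ_of_le hj), add_zero]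
  have h2 : (q : ℕ) % (n + 1) = j := by
    rw [hq, Nat.mul_add_mod, Nat.mod_eq_of_lt (Nat.lt_succ_of_le hj)]
  rw [ladderColor, h1, h2]

/-- The language of the ladder with the coloring `ladderColor n d`. -/
def ladderLanguage (n B d : ℕ) : Set (Stream' Letter) :=
  (ladder n B).mullerLanguage (Automaton.parityFamily (ladderColor n d))

namespace Automaton

theorem ladder_evalFrom_replicate_a (n B : ℕ) (p : Fin ((n + 1) * B + 1)) (k : ℕ) :
    ((ladder n B).evalFrom p (List.replicate k .a) : ℕ) = min (p + k) ((n + 1) * B) := by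
  induction k with
  | zero =>
    have := p.2
    simp only [List.replicate_zero, evalFrom, List.foldl_nil]
    omega
  | succ k ih =>
    rw [List.replicate_succ', evalFrom_append]
    change min (_ + 1) ((n + 1) * B) = _
    rw [ih]
    omega

theorem ladder_evalFrom_b (n B : ℕ) (p : Fin ((n + 1) * B + 1)) :
    ((ladder n B).evalFrom p [.b] : ℕ) = (n + 1) * (p / (n + 1)) :=
  rfl

theorem ladder_reachable (n B : ℕ) (q : Fin ((n + 1) * B + 1)) :
    ∃ x, (ladder n B).evalFrom (ladder n B).init x = q := by
  refine ⟨List.replicate q .a, Fin.ext ?_⟩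
  rw [ladder_evalFrom_replicate_a]
  have := q.2
  change min (0 + _) _ = _
  omega

/-- Any two states `p < q` of the ladder are distinguished by the word `a ⋯ a b b b ⋯` that leads
from `q` to the sink and from `p` to the start of the last block: the colors of these two
states are consecutive numbers. -/
theorem ladder_distinguishable {n B d : ℕ} {p q : Fin ((n + 1) * B + 1)} (hpq : p < q) :
    ((ladder n B).startAt p).mullerLanguage (parityFamily (ladderColor n d)) ≠
      ((ladder n B).startAt q).mullerLanguage (parityFamily (ladderColor n d)) := by
  have hpq' : (p : ℕ) < q := hpq
  have hq := q.2
  obtain ⟨C, rfl⟩ : ∃ C, B = C + 1 := by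
    rcases B with _ | C
    · simp at hq
      omega
    · exact ⟨C, rfl⟩
  have hmul : (n + 1) * (C + 1) = (n + 1) * C + (n + 1) := Nat.mul_succ _ _
  let x : List Letter := List.replicate ((n + 1) * C + n - p) .a ++ [.b]
  have hx : ∀ s : Fin ((n + 1) * (C + 1) + 1), ((ladder n (C + 1)).evalFrom s x : ℕ) =
      (n + 1) * (min (s + ((n + 1) * C + n - p)) ((n + 1) * (C + 1)) / (n + 1)) := by
    intro s
    rw [evalFrom_append, ladder_evalFrom_b, ladder_evalFrom_replicate_a]
  have hp1 : ((ladder n (C + 1)).evalFrom p x : ℕ) = (n + 1) * C + 0 := by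
    rw [hx, show min ((p : ℕ) + ((n + 1) * C + n - p)) ((n + 1) * (C + 1)) = (n + 1) * C + n by
      omega, Nat.mul_add_div (Nat.succ_pos n), Nat.div_eq_of_lt (Nat.lt_succ_self n)]
    rfl
  have hq1 : ((ladder n (C + 1)).evalFrom q x : ℕ) = (n + 1) * (C + 1) + 0 := by
    rw [hx, min_eq_right (by omega),
      Nat.mul_div_cancel_left _ (Nat.succ_pos n), add_zero]
  have key : ∀ s i, ((ladder n (C + 1)).evalFrom s x : ℕ) = (n + 1) * i + 0 →
      (x ++ₛ Stream'.cycle [.b] (List.cons_ne_nil _ _) ∈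
        ((ladder n (C + 1)).startAt s).mullerLanguage (parityFamily (ladderColor n d)) ↔
          Odd (d + i + n)) := by
    intro s i hs
    have hfix : ((ladder n (C + 1)).startAt s).evalFrom
        ((ladder n (C + 1)).evalFrom s x) [.b] = (ladder n (C + 1)).evalFrom s x := by
      apply Fin.ext
      change (n + 1) * (_ / (n + 1)) = _
      rw [hs, add_zero, Nat.mul_div_cancel_left _ (Nat.succ_pos n)]
    rw [mullerLanguage, Set.mem_ofPred_eq,
      infStates_append_cycle_of_fixed _ x .b (r := (ladder n (C + 1)).evalFrom s x) rfl hfix]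
    apply mem_parityFamily_iff
    rw [Set.image_singleton, ladderColor_of_val (Nat.zero_le n) hs]
    exact isLeast_singleton
  intro h
  have h1 := key p C hp1
  rw [h, key q (C + 1) hq1] at h1
  grind

theorem ladder_isIsomorphic_rightcon (n B d : ℕ) :
    (ladder n B).IsIsomorphic (rightcon (ladderLanguage n B d)) := by
  refine isIsomorphic_rightcon _ _ (ladder_reachable n B) fun p q h => ?_
  rcases lt_trichotomy p q with hpq | hpq | hpq
  · exact absurd h (ladder_distinguishable hpq)
  · exact hpq
  · exact absurd h.symm (ladder_distinguishable hpq)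

end Automaton

theorem ladderLanguage_mem_IM (n B d : ℕ) : ladderLanguage n B d ∈ IM Letter :=
  ⟨_, inferInstance, ladder n B, _, Automaton.ladder_isIsomorphic_rightcon n B d, rfl⟩

theorem finite_letter : Finite Letter :=
  Finite.of_injective (fun c : Letter => decide (c = .a)) fun x y => by
    cases x <;> cases y <;> simp

theorem ladderLanguage_mem_IT (n B d : ℕ) : ladderLanguage n B d ∈ IT Letter :=
  have := finite_letter
  ⟨_, inferInstance, ladder n B, _, Automaton.ladder_isIsomorphic_rightcon n B d,
    Automaton.tableLanguage_eq_mullerLanguage _ _⟩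

theorem ladderLanguage_mem_IP (n B : ℕ) {d : ℕ} (hd : 1 ≤ d) :
    ladderLanguage n B d ∈ IP Letter := by
  refine ⟨_, inferInstance, ladder n B, d + B + n, ladderColor n d, fun q => ?_,
    Automaton.ladder_isIsomorphic_rightcon n B d, Automaton.parityLanguage_eq_mullerLanguage _ _⟩
  have : (q : ℕ) / (n + 1) ≤ B := by
    exact Nat.div_le_of_le_mul (Nat.lt_succ_iff.1 q.2)
  rw [ladderColor, Set.mem_Icc]
  exact ⟨by rw [add_assoc]; exact hd.trans (Nat.le_add_right d _),
    Nat.add_le_add (Nat.add_le_add_left this d) (Nat.sub_le n _)⟩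

namespace Automaton

/-! ### Chains and superchains of the ladder -/

theorem ladder_block_le (n B : ℕ) (p : Fin ((n + 1) * B + 1)) (x : List Letter) :
    (p : ℕ) / (n + 1) ≤ ((ladder n B).evalFrom p x : ℕ) / (n + 1) := by
  induction x generalizing p with
  | nil => exact le_rfl
  | cons c x ih =>
    refine le_trans ?_ (ih ((ladder n B).step p c))
    cases c with
    | a =>
      have := p.2
      exact Nat.div_le_div_right (show (p : ℕ) ≤ min ((p : ℕ) + 1) ((n + 1) * B) by omega)
    | b =>
      exact ((Nat.mul_div_cancel_left _ (Nat.succ_pos n)).symm).le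

/-- A chain of the ladder lies in one block `i`, and its minimal colors are strictly decreasing.
Hence it has at most `n` alternations; if it has `n` of them, then all colors from `d + i + n`
to `d + i` occur, so that the block contains a state with the least of these colors. -/
theorem ladder_chain {n B d k : ℕ} {S : Fin (k + 1) → Set (Fin ((n + 1) * B + 1))}
    (hS : (ladder n B).IsChain (parityFamily (ladderColor n d)) k S) :
    ∃ i, (∀ q ∈ S 0, (q : ℕ) / (n + 1) = i) ∧ k ≤ n ∧
      (k = n → (S 0 ∈ parityFamily (ladderColor n d) ↔ Odd (d + i + n)) ∧
        (n + 1) * i + n ≤ (n + 1) * B) := by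
  obtain ⟨p, hp⟩ := (hS.scc (Fin.last k)).nonempty
  have hblock : ∀ l, ∀ q ∈ S l, (q : ℕ) / (n + 1) = (p : ℕ) / (n + 1) := by
    intro l q hq
    have hq' := hS.strictMono.monotone (Fin.le_last l) hq
    obtain ⟨x, -, hx, -⟩ := (hS.scc (Fin.last k)).connected p hp q hq'
    obtain ⟨y, -, hy, -⟩ := (hS.scc (Fin.last k)).connected q hq' p hp
    refine le_antisymm ?_ ?_
    · rw [← hy]
      exact ladder_block_le n B q y
    · rw [← hx]
      exact ladder_block_le n B p x
  set i := (p : ℕ) / (n + 1)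
  have hleast : ∀ l, ∃ c, IsLeast (ladderColor n d '' S l) c := fun l =>
    ⟨sInf _, Nat.sInf_mem ((hS.scc l).nonempty.image _), fun c hc => Nat.sInf_le hc⟩
  choose c hc using hleast
  have hanti : ∀ l : Fin k, c l.succ < c l.castSucc := by
    intro l
    refine lt_of_le_of_ne ?_ ?_
    · exact (hc l.succ).2
        (Set.image_mono (hS.strictMono.monotone (Fin.castSucc_lt_succ).le) (hc l.castSucc).1)
    · intro h
      have := hS.alternates l
      rw [mem_parityFamily_iff (hc _), mem_parityFamily_iff (hc _), h] at this
      tauto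
  have hsum : ∀ l : Fin (k + 1), c l + l ≤ c 0 := by
    intro l
    induction l using Fin.induction with
    | zero => simp
    | succ l ih =>
      have := hanti l
      rw [Fin.val_succ]
      rw [Fin.val_castSucc] at ih
      omega
  have hlast := hsum (Fin.last k)
  rw [Fin.val_last] at hlast
  obtain ⟨q, hq, hqc⟩ := (hc (Fin.last k)).1
  obtain ⟨r, hr, hrc⟩ := (hc 0).1
  have hqb := hblock _ q hq
  have hrb := hblock _ r hr
  have hqm := Nat.div_add_mod (q : ℕ) (n + 1)
  have hqn := Nat.mod_lt (q : ℕ) (Nat.succ_pos n)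
  rw [ladderColor, hqb] at hqc
  rw [ladderColor, hrb] at hrc
  rw [hqb] at hqm
  refine ⟨i, hblock 0, by omega, fun hk => ⟨?_, ?_⟩⟩
  · rw [mem_parityFamily_iff (hc 0), show c 0 = d + i + n by omega]
  · have := q.2
    omega

/-- In a superchain of the ladder with `n` alternations the blocks of the chains are strictly
increasing, because the parity of the color at which a block starts alternates with the block.
If only `m` blocks are available, there are at most `m` chains, and `m` chains use all blocks. -/
theorem ladder_superchain {n B d m r : ℕ} (hm : ∀ i, (n + 1) * i + n ≤ (n + 1) * B → i < m)
    {C : Fin r → Fin (n + 1) → Set (Fin ((n + 1) * B + 1))}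
    (hC : (ladder n B).IsSuperchain (parityFamily (ladderColor n d)) n r C) :
    r ≤ m ∧ (r = m → ∀ i : Fin r, (i : ℕ) = 0 →
      (C i 0 ∈ parityFamily (ladderColor n d) ↔ Odd (d + n))) := by
  have hex : ∀ l, ∃ i, (∀ q ∈ C l 0, (q : ℕ) / (n + 1) = i) ∧
      (C l 0 ∈ parityFamily (ladderColor n d) ↔ Odd (d + i + n)) ∧ i < m := by
    intro l
    obtain ⟨i, h1, -, h2⟩ := ladder_chain (hC.chain l)
    exact ⟨i, h1, (h2 rfl).1, hm i (h2 rfl).2⟩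
  choose β hβ hodd hlt using hex
  have hstep : ∀ l l' : Fin r, (l' : ℕ) = l + 1 → β l < β l' := by
    intro l l' h
    obtain ⟨s, hs, t, ht, x, rfl⟩ := hC.accessible l l' h
    refine lt_of_le_of_ne ?_ ?_
    · rw [← hβ l s hs, ← hβ l' _ ht]
      exact ladder_block_le n B s x
    · intro heq
      have := hC.alternates l l' h
      rw [hodd, hodd, heq] at this
      tauto
  have hsum : ∀ l (h0 : 0 < r) (hl : l < r), β ⟨0, h0⟩ + l ≤ β ⟨l, hl⟩ := by
    intro l h0
    induction l with
    | zero => exact fun _ => le_rfl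
    | succ l ih =>
      intro hl
      have h1 := ih (Nat.lt_of_succ_lt hl)
      have h2 := hstep ⟨l, Nat.lt_of_succ_lt hl⟩ ⟨l + 1, hl⟩ rfl
      omega
  constructor
  · rcases Nat.eq_zero_or_pos r with rfl | h0
    · exact Nat.zero_le m
    · have h1 := hsum (r - 1) h0 (by omega)
      have h2 := hlt ⟨r - 1, by omega⟩
      omega
  · rintro rfl ⟨l, hl⟩ (rfl : l = 0)
    have h1 := hsum (r - 1) hl (by omega)
    have h2 := hlt ⟨r - 1, by omega⟩
    rw [hodd, show β ⟨0, hl⟩ = 0 by omega, add_zero]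

/-! ### Loop words -/

/-- The word that makes a block of the ladder loop through its first `j + 1` states. Each of these
words starts with the `K`-th power of the preceding one, so that a `K`-state automaton that reads
the longer word runs through a cycle of the shorter word. -/
def loopWord (K : ℕ) : ℕ → List Letter
  | 0 => [.b]
  | j + 1 => rep K (loopWord K j) ++ (List.replicate (j + 1) .a ++ [.b])

theorem loopWord_ne_nil (K j : ℕ) : loopWord K j ≠ [] := by
  cases j <;> simp [loopWord]

theorem ladder_loopWord {n B i : ℕ} (K : ℕ) {p : Fin ((n + 1) * B + 1)}
    (hp : (p : ℕ) = (n + 1) * i) {j : ℕ} (hj : j ≤ n) (hB : (n + 1) * i + n ≤ (n + 1) * B) :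
    (ladder n B).evalFrom p (loopWord K j) = p ∧
      (ladder n B).Stays {q | (n + 1) * i ≤ q ∧ (q : ℕ) ≤ (n + 1) * i + j} p (loopWord K j) ∧
      ∃ z, z <+: loopWord K j ∧ ((ladder n B).evalFrom p z : ℕ) = (n + 1) * i + j := by
  -- The loop `a ⋯ a b` with at most `n` letters `a`.
  have hsimple : ∀ l ≤ n, (ladder n B).evalFrom p (List.replicate l .a ++ [.b]) = p ∧
      (ladder n B).Stays {q | (n + 1) * i ≤ q ∧ (q : ℕ) ≤ (n + 1) * i + l} p
        (List.replicate l .a ++ [.b]) := by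
    intro l hl
    have heval : (ladder n B).evalFrom p (List.replicate l .a ++ [.b]) = p := by
      apply Fin.ext
      rw [evalFrom_append, ladder_evalFrom_b, ladder_evalFrom_replicate_a, hp,
        min_eq_left (by omega), Nat.mul_add_div (Nat.succ_pos n), Nat.div_eq_of_lt (by omega),
        add_zero]
    refine ⟨heval, fun y hy => ?_⟩
    rcases List.prefix_concat_iff.1 hy with rfl | hy
    · rw [heval]
      exact ⟨hp.ge, by omega⟩
    · obtain ⟨h1, h2⟩ := List.prefix_replicate_iff.1 hy
      rw [h2, Set.mem_ofPred_eq, ladder_evalFrom_replicate_a, hp]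
      omega
  induction j with
  | zero =>
    obtain ⟨h1, h2⟩ := hsimple 0 hj
    exact ⟨h1, h2, [], List.nil_prefix, hp⟩
  | succ j ih =>
    obtain ⟨h1, h2, -⟩ := ih (Nat.le_of_succ_le hj)
    obtain ⟨h3, h4⟩ := hsimple (j + 1) hj
    have hK := (ladder n B).evalFrom_rep_of_fixed h1 K
    refine ⟨?_, ?_, rep K (loopWord K j) ++ List.replicate (j + 1) .a, ?_, ?_⟩
    · rw [loopWord, evalFrom_append, hK, h3]
    · refine Stays.append (fun y hy => ?_) (by rwa [hK])
      have := h2.rep h1 K y hy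
      exact ⟨this.1, by have := this.2; omega⟩
    · rw [loopWord, ← List.append_assoc]
      exact List.prefix_append _ _
    · rw [evalFrom_append, hK, ladder_evalFrom_replicate_a, hp]
      omega

theorem ladder_mem_iff_of_loopWord {n B d i : ℕ} (K : ℕ) {u : List Letter}
    (hu : ((ladder n B).evalFrom (ladder n B).init u : ℕ) = (n + 1) * i) {j : ℕ} (hj : j ≤ n)
    (hB : (n + 1) * i + n ≤ (n + 1) * B) :
    u ++ₛ Stream'.cycle (loopWord K j) (loopWord_ne_nil K j) ∈ ladderLanguage n B d ↔
      Odd (d + i + (n - j)) := by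
  obtain ⟨h1, h2, z, hz, hzv⟩ := ladder_loopWord K hu hj hB
  rw [ladderLanguage, mullerLanguage, Set.mem_ofPred_eq,
    infStates_append_cycle _ u _ Nat.one_pos (evalFrom_rep_of_fixed _ h1 1)]
  apply mem_parityFamily_iff
  constructor
  · exact ⟨_, evalFrom_mem_orbit _ _ _ hz, ladderColor_of_val hj hzv⟩
  · rintro _ ⟨q, hq, rfl⟩
    obtain ⟨h3, h4⟩ := h2.orbit_subset h1 (loopWord_ne_nil K j) hq
    rw [ladderColor_of_val (i := i) (j := (q : ℕ) - (n + 1) * i) (by omega) (by omega)]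
    omega

/-! ### Chains and superchains of equivalent automata -/

/-- Every Muller automaton for the language of the ladder has, for each block `i`, an increasing
sequence of SCCs whose acceptance is that of the SCCs of the block. They are orbits of loop words;
the longest word is chosen first, and each shorter one is read from a state in the orbit of
the preceding one. -/
theorem exists_scc_sequence {n B d i : ℕ} {Q : Type} [Finite Q] {M : Automaton Letter Q}
    {F : Set (Set Q)} (hM : M.mullerLanguage F = ladderLanguage n B d)
    (hB : (n + 1) * i + n ≤ (n + 1) * B) {j : ℕ} (hj : j ≤ n) (u : List Letter)
    (hu : ((ladder n B).evalFrom (ladder n B).init u : ℕ) = (n + 1) * i) :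
    ∃ (x : List Letter) (S : ℕ → Set Q),
      ((ladder n B).evalFrom (ladder n B).init (u ++ x) : ℕ) = (n + 1) * i ∧
      M.evalFrom M.init (u ++ x) ∈ S 0 ∧
      (∀ l ≤ j, M.IsSCC (S l) ∧ (S l ∈ F ↔ Odd (d + i + (n - l)))) ∧
      (∀ l < j, S l ⊆ S (l + 1)) ∧
      S j ⊆ M.orbit (M.evalFrom M.init u) (loopWord (Nat.card Q) j) (loopWord_ne_nil _ j) := by
  induction j generalizing u with
  | zero =>
    set y := loopWord (Nat.card Q) 0
    obtain ⟨e, he, hed⟩ := M.exists_evalFrom_rep_card (M.evalFrom M.init u) y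
    rw [← evalFrom_append M M.init u] at hed
    have hv : ((ladder n B).evalFrom (ladder n B).init (u ++ rep (Nat.card Q) y) : ℕ) =
        (n + 1) * i := by
      rw [evalFrom_append, evalFrom_rep_of_fixed _ (ladder_loopWord _ hu hj hB).1, hu]
    refine ⟨rep (Nat.card Q) y, fun _ => M.orbit _ y (loopWord_ne_nil _ 0), hv,
      M.mem_orbit_self _ _, fun l hl => ⟨M.isSCC_orbit _ _ he hed, ?_⟩, ?_, ?_⟩
    · rw [Nat.le_zero.1 hl, ← ladder_mem_iff_of_loopWord (Nat.card Q) hv hj hB, ← hM,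
        ← M.infStates_append_cycle _ _ he hed]
      rfl
    · exact fun l hl => absurd hl (Nat.not_lt_zero l)
    · dsimp only
      rw [evalFrom_append]
      exact M.orbit_evalFrom_rep_subset _ _ _
  | succ j ih =>
    set y := loopWord (Nat.card Q) (j + 1)
    obtain ⟨e, he, hed⟩ := M.exists_evalFrom_rep_card (M.evalFrom M.init u) y
    rw [← evalFrom_append M M.init u] at hed
    have hv : ((ladder n B).evalFrom (ladder n B).init (u ++ rep (Nat.card Q) y) : ℕ) =
        (n + 1) * i := by
      rw [evalFrom_append, evalFrom_rep_of_fixed _ (ladder_loopWord _ hu hj hB).1, hu]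
    obtain ⟨x, S, h1, h2, h3, h4, h5⟩ := ih (Nat.le_of_succ_le hj) _ hv
    let T : Set Q := M.orbit (M.evalFrom M.init (u ++ rep (Nat.card Q) y)) y (loopWord_ne_nil _ _)
    have hT : T ∈ F ↔ Odd (d + i + (n - (j + 1))) := by
      rw [← ladder_mem_iff_of_loopWord (Nat.card Q) hv hj hB, ← hM]
      change M.orbit _ y _ ∈ F ↔ _
      rw [← M.infStates_append_cycle _ _ he hed]
      rfl
    refine ⟨rep (Nat.card Q) y ++ x, fun l => if l = j + 1 then T else S l, ?_, ?_, ?_, ?_, ?_⟩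
    · rwa [← List.append_assoc]
    · rwa [← List.append_assoc]
    · intro l hl
      dsimp only
      split_ifs with h
      · subst h
        exact ⟨M.isSCC_orbit _ _ he hed, hT⟩
      · exact h3 l (by omega)
    · intro l hl
      dsimp only
      rw [if_neg hl.ne]
      split_ifs with h
      · obtain rfl : l = j := by omega
        exact h5.trans (M.orbit_subset_of_rep_prefix _ _ _)
      · exact h4 l (by omega)
    · dsimp only
      rw [if_pos rfl]
      change M.orbit _ y _ ⊆ _
      rw [evalFrom_append]
      exact M.orbit_evalFrom_rep_subset _ _ _

theorem exists_chain {n B d i : ℕ} {Q : Type} [Finite Q] {M : Automaton Letter Q}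
    {F : Set (Set Q)} (hM : M.mullerLanguage F = ladderLanguage n B d)
    (hB : (n + 1) * i + n ≤ (n + 1) * B) (u : List Letter)
    (hu : ((ladder n B).evalFrom (ladder n B).init u : ℕ) = (n + 1) * i) :
    ∃ (x : List Letter) (S : Fin (n + 1) → Set Q), M.IsChain F n S ∧
      ((ladder n B).evalFrom (ladder n B).init (u ++ x) : ℕ) = (n + 1) * i ∧
      M.evalFrom M.init (u ++ x) ∈ S 0 ∧ (S 0 ∈ F ↔ Odd (d + i + n)) := by
  obtain ⟨x, S, h1, h2, h3, h4, -⟩ := exists_scc_sequence hM hB le_rfl u hu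
  have halt : ∀ l < n, (S l ∈ F ↔ S (l + 1) ∉ F) := by
    intro l hl
    rw [(h3 l hl.le).2, (h3 (l + 1) hl).2, show n - l = n - (l + 1) + 1 by omega]
    grind
  refine ⟨x, fun l => S l, ⟨fun l => (h3 l (Nat.lt_succ_iff.1 l.2)).1, ?_, fun l => halt l l.2⟩,
    h1, h2, (h3 0 (Nat.zero_le n)).2⟩
  refine Fin.strictMono_iff_lt_succ.2 fun l => lt_of_le_of_ne (h4 l l.2) fun h => ?_
  have := halt l l.2
  change S l = S (l + 1) at h
  rw [← h] at this
  tauto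

/-- The chains of the successive blocks are accessible from each other: after the `i`-th chain the
word `a ⋯ a` with `n + 1` letters leads to the next block. -/
theorem exists_superchain {n B d m : ℕ} {Q : Type} [Finite Q] {M : Automaton Letter Q}
    {F : Set (Set Q)} (hM : M.mullerLanguage F = ladderLanguage n B d)
    (hm : ∀ i < m, (n + 1) * i + n ≤ (n + 1) * B) :
    ∃ C : Fin m → Fin (n + 1) → Set Q, M.IsSuperchain F n m C := by
  have hex : ∀ (i : ℕ) (u : List Letter), ∃ (x : List Letter) (S : Fin (n + 1) → Set Q),
      i < m → ((ladder n B).evalFrom (ladder n B).init u : ℕ) = (n + 1) * i →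
      M.IsChain F n S ∧
      ((ladder n B).evalFrom (ladder n B).init (u ++ x) : ℕ) = (n + 1) * i ∧
      M.evalFrom M.init (u ++ x) ∈ S 0 ∧ (S 0 ∈ F ↔ Odd (d + i + n)) := by
    intro i u
    by_cases h : i < m ∧ ((ladder n B).evalFrom (ladder n B).init u : ℕ) = (n + 1) * i
    · obtain ⟨x, S, hS⟩ := exists_chain hM (hm i h.1) u h.2
      exact ⟨x, S, fun _ _ => hS⟩
    · exact ⟨[], fun _ => ∅, fun h1 h2 => absurd ⟨h1, h2⟩ h⟩
  choose x S hS using hex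
  let U : ℕ → List Letter := fun i =>
    Nat.rec [] (fun i u => u ++ x i u ++ List.replicate (n + 1) .a) i
  have hU : ∀ i, U (i + 1) = U i ++ x i (U i) ++ List.replicate (n + 1) .a := fun i => rfl
  have hblock : ∀ i < m, ((ladder n B).evalFrom (ladder n B).init (U i) : ℕ) = (n + 1) * i := by
    intro i
    induction i with
    | zero => exact fun _ => (Nat.mul_zero _).symm
    | succ i ih =>
      intro hi
      have h := (hS i (U i) (by omega) (ih (by omega))).2.1
      have hB := hm (i + 1) hi
      rw [hU, evalFrom_append, ladder_evalFrom_replicate_a, h]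
      rw [Nat.mul_succ] at hB ⊢
      omega
  have hS' := fun i hi => hS i (U i) hi (hblock i hi)
  refine ⟨fun i => S i (U i), fun i => (hS' i i.2).1, fun i j hij => ?_, fun i j hij => ?_⟩
  · refine ⟨_, (hS' i i.2).2.2.1, _, (hS' j j.2).2.2.1,
      List.replicate (n + 1) .a ++ x j (U j), ?_⟩
    rw [← evalFrom_append, ← List.append_assoc, hij, hU]
  · rw [(hS' i i.2).2.2.2, (hS' j j.2).2.2.2, hij]
    grind

end Automaton

/-! ### Wagner classes -/

/-- With `m` blocks in which chains with `n` alternations fit, the language of the ladder lies in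
the Wagner class `DM_{n,m}^p`, if the coloring has the polarity `p`. -/
theorem ladderLanguage_mem_DM {n B d m : ℕ} {p : Polarity}
    (hm : ∀ i, (n + 1) * i + n ≤ (n + 1) * B → i < m) (hp : p.Admits (Odd (d + n))) :
    ladderLanguage n B d ∈ DM Letter p n m := by
  refine ⟨_, inferInstance, ladder n B, _, rfl, fun k S hS => ?_, fun k r C hk hC => ?_⟩
  · obtain ⟨i, -, h, -⟩ := Automaton.ladder_chain hS
    exact_mod_cast h
  · obtain rfl : k = n := by exact_mod_cast hk
    obtain ⟨h1, h2⟩ := Automaton.ladder_superchain hm hC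
    refine ⟨by exact_mod_cast h1, fun hr i hi => ?_⟩
    rwa [propext (h2 (by exact_mod_cast hr) i hi)]

/-- Since every automaton for the language of the ladder has chains with `n` alternations and
superchains of length `m`, a Wagner class that contains the language admits them. -/
theorem le_of_ladderLanguage_mem_DM {n B d m : ℕ} {p : Polarity} {k r : ℤ} (hm0 : 0 < m)
    (hm : ∀ i < m, (n + 1) * i + n ≤ (n + 1) * B) (h : ladderLanguage n B d ∈ DM Letter p k r) :
    (n : ℤ) ≤ k ∧ ((n : ℤ) = k → (m : ℤ) ≤ r) := by
  obtain ⟨Q, _, M, F, hM, h1, h2⟩ := h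
  obtain ⟨C, hC⟩ := Automaton.exists_superchain hM hm
  exact ⟨h1 n _ (hC.chain ⟨0, hm0⟩), fun hk => (h2 n m C hk hC).1⟩

/-- The number of blocks of the ladder for `DM_{n,m}^p`: for `n = 0` the sink plays the role of the
last block. -/
def blockCount (n m : ℕ) : ℕ :=
  if n = 0 then m - 1 else m

theorem blockCount_spec {n m : ℕ} (hm : 0 < m) (i : ℕ) :
    (n + 1) * i + n ≤ (n + 1) * blockCount n m ↔ i < m := by
  rcases Nat.eq_zero_or_pos n with rfl | hn
  · simp only [blockCount, if_pos]
    omega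
  · rw [blockCount, if_neg hn.ne']
    constructor
    · intro h
      by_contra hi
      have := Nat.mul_le_mul_left (n + 1) (not_lt.1 hi)
      omega
    · intro h
      have := Nat.mul_le_mul_left (n + 1) (Nat.succ_le_of_lt h)
      rw [Nat.mul_succ] at this
      omega

end Rightcon

open Rightcon in
theorem mainTheorem2 (n m : ℕ) (hnm : n ≠ 0 ∨ m ≠ 0) (p : Rightcon.Polarity) :
    ∃ L : Set (Stream' Rightcon.Letter),
      L ∈ Rightcon.IT Rightcon.Letter ∩ Rightcon.IM Rightcon.Letter ∩
        Rightcon.IP Rightcon.Letter ∩ Rightcon.DM Rightcon.Letter p (n : ℤ) (m : ℤ) ∧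
      L ∉ Rightcon.DM Rightcon.Letter p ((n : ℤ) - 1) (m : ℤ) ∧
      L ∉ Rightcon.DM Rightcon.Letter p (n : ℤ) ((m : ℤ) - 1) := by
  rcases Nat.eq_zero_or_pos m with rfl | hm
  · -- Chains with `n` alternations are forbidden, those with `n - 1` alternations are needed.
    obtain ⟨k, rfl⟩ := Nat.exists_eq_succ_of_ne_zero (hnm.resolve_right fun h => h rfl)
    have hB := blockCount_spec (n := k) Nat.one_pos
    refine ⟨ladderLanguage k (blockCount k 1) 1, ⟨⟨⟨ladderLanguage_mem_IT _ _ _,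
      ladderLanguage_mem_IM _ _ _⟩, ladderLanguage_mem_IP _ _ le_rfl⟩, ?_⟩, fun h => ?_,
      fun h => ?_⟩
    · have hlt : ∀ l S, (ladder k (blockCount k 1)).IsChain
          (Automaton.parityFamily (ladderColor k 1)) l S → l ≤ k := fun l S hS =>
        (Automaton.ladder_chain hS).choose_spec.2.1
      refine ⟨_, inferInstance, ladder k (blockCount k 1), _, rfl, fun l S hS => ?_,
        fun l r C hl hC => ?_⟩
      · have := hlt l S hS
        push_cast
        omega
      · obtain rfl : r = 0 := by
          by_contra hr
          have := hlt l _ (hC.chain ⟨0, Nat.pos_of_ne_zero hr⟩)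
          push_cast at hl
          omega
        exact ⟨le_rfl, fun _ i => i.elim0⟩
    · have := (le_of_ladderLanguage_mem_DM Nat.one_pos (fun i => (hB i).2) h).2 (by push_cast; ring)
      norm_num at this
    · -- The empty superchain has more than `-1` chains.
      obtain ⟨Q, _, M, F, -, -, h2⟩ := h
      have := (h2 (k + 1) 0 (fun i => i.elim0) rfl
        ⟨fun i => i.elim0, fun i => i.elim0, fun i => i.elim0⟩).1
      norm_num at this
  · have hB := blockCount_spec (n := n) hm
    -- The smallest SCC of the first block has color `d + n`, whose parity is the polarity.
    obtain ⟨d, hd, hp⟩ : ∃ d, 1 ≤ d ∧ p.Admits (Odd (d + n)) := by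
      cases p with
      | pos => exact ⟨n + 1, by omega, n, by ring⟩
      | neg => exact ⟨n + 2, by omega, Nat.not_odd_iff_even.2 ⟨n + 1, by ring⟩⟩
      | both => exact ⟨1, le_rfl, trivial⟩
    refine ⟨ladderLanguage n (blockCount n m) d, ⟨⟨⟨ladderLanguage_mem_IT _ _ _,
      ladderLanguage_mem_IM _ _ _⟩, ladderLanguage_mem_IP _ _ hd⟩,
      ladderLanguage_mem_DM (fun i => (hB i).1) hp⟩, fun h => ?_, fun h => ?_⟩
    · have := (le_of_ladderLanguage_mem_DM hm (fun i => (hB i).2) h).1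
      omega
    · have := (le_of_ladderLanguage_mem_DM hm (fun i => (hB i).2) h).2 rfl
      omega
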